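/- Consider the linear model with Gaussian random design: one observes $Z=(Z_1,\dots,Z_n)$ with $Z_i=(y_i,X_{i\cdot})\in\mathbb R\times\mathbb R^p$ and $y=X\beta+\epsilon$, where the rows $X_{i\cdot}$ are i.i.d. $N_p(0,\Omega^{-1})$ and independent of $\epsilon\sim N_n(0,\sigma^2 I)$; write $\theta=(\beta,\Omega,\sigma)$. For $\sigma_0>0$ let $\Theta(k,I,\sigma_0)=\{(\beta,I,\sigma_0):\|\beta\|_0\le k\}$. For sets of parameters $\Theta_1\subseteq\Theta$ and a functional $T(\beta)$ let $$L^*_\alpha(\Theta_1,\Theta,T)=\inf_{[l,u]}\ \sup_{\theta\in\Theta_1}\mathbb E_\theta\,[u(Z)-l(Z)],$$ the infimum being over all confidence intervals $[l(Z),u(Z)]$ with $\inf_{\theta\in\Theta}\mathbb P_\theta(l(Z)\le T(\beta)\le u(Z))\ge 1-\alpha$. Theorem 8. Let $0<\alpha<\frac12$, $c>0$, $0\le\gamma<\frac12$, $\bar c\ge1$, $c_q>0$ and $2\gamma<\gamma_q\le1$ be constants. There is a constant $c_1>0$, depending only on $\alpha,c,\gamma,\bar c,c_q,\gamma_q$,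 such that for all $n\ge1$ and $p\ge 1$, all $\sigma_0>0$, all integers $0\le k_1\le k\le c\min\{p^\gamma,\frac{n}{\log p}\}$ (where $\frac{n}{\log p}=\infty$ if $p=1$), and every dense loading $\xi$, that is, every nonzero $\xi\in\mathbb R^p$ with $\|\xi\|_0\ge c_q p^{\gamma_q}$ and $\max_{j\in\mathrm{supp}(\xi)}|\xi_j|\le\bar c\,\min_{j\in\mathrm{supp}(\xi)}|\xi_j|$, $$L^*_\alpha\big(\Theta(k_1,I,\sigma_0),\Theta(k,I,\sigma_0),\xi^{\intercal}\beta\big)\ \ge\ c_1\|\xi\|_\infty\,\sigma_0\,\max\left\{\sqrt{kk_1}\sqrt{\frac{\log p}{n}},\ \min\left\{k\sqrt{\frac{\log p}{n}},\ \frac{\sqrt k}{n^{1/4}}\right\}\right\}.$$ -/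

import Mathlib

open MeasureTheory ProbabilityTheory

noncomputable section

namespace HDLinReg

/-- The parameter `θ = (β, Ω, σ)` of the high-dimensional linear model with `p` covariates:
the regression vector, the precision matrix of the design and the noise level. -/
structure Param (p : ℕ) where
  beta : Fin p → ℝ
  Omega : Matrix (Fin p) (Fin p) ℝ
  sigma : ℝ

/-- The observed data `Z = (Z₁, …, Zₙ)`, where `Zᵢ = (yᵢ, Xᵢ) ∈ ℝ × ℝᵖ`. -/
abbrev Data (n p : ℕ) : Type := Fin n → ℝ × EuclideanSpace ℝ (Fin p)

/-- The law of one observation `(yᵢ, Xᵢ)`: the covariate vector `Xᵢ ∼ N_p(0, Ω⁻¹)` and the noise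
`εᵢ ∼ N(0, σ²)` are independent, and `yᵢ = Xᵢ β + εᵢ`. -/
def rowLaw {p : ℕ} (θ : Param p) : Measure (ℝ × EuclideanSpace ℝ (Fin p)) :=
  ((multivariateGaussian (0 : EuclideanSpace ℝ (Fin p)) θ.Omega⁻¹).prod
      (gaussianReal 0 (Real.toNNReal (θ.sigma ^ 2)))).map
    (fun w => ((∑ j, w.1 j * θ.beta j) + w.2, w.1))

/-- The law `ℙ_θ` of the data: `n` independent observations. This is the model `y = X β + ε` with
i.i.d. rows of `X` and `ε ∼ N_n(0, σ² I)` independent of `X`. -/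
def law (n : ℕ) {p : ℕ} (θ : Param p) : Measure (Data n p) :=
  Measure.pi (fun _ : Fin n => rowLaw θ)

/-- A confidence interval `[l(Z), u(Z)]`: two statistics with `l ≤ u`. -/
structure ConfInterval (n p : ℕ) where
  lower : Data n p → ℝ
  upper : Data n p → ℝ
  measurable_lower : Measurable lower
  measurable_upper : Measurable upper
  lower_le_upper : ∀ z, lower z ≤ upper z

/-- `ℐ_α(Θ, T)`: the confidence intervals for `T` of level `1 - α` over `Θ`. -/
def levelIntervals (n : ℕ) {p : ℕ} (α : ℝ) (Θ : Set (Param p)) (T : Param p → ℝ) :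
    Set (ConfInterval n p) :=
  {C | ENNReal.ofReal (1 - α) ≤
    ⨅ θ ∈ Θ, law n θ {z | C.lower z ≤ T θ ∧ T θ ≤ C.upper z}}

/-- `𝔼_θ L(CI)`: the expected length of a confidence interval, with values in `[0, ∞]`. -/
def expectedLength {n p : ℕ} (C : ConfInterval n p) (θ : Param p) : ENNReal :=
  ∫⁻ z, ENNReal.ofReal (C.upper z - C.lower z) ∂(law n θ)

/-- `L(CI, Θ, T)`: the maximum expected length over `Θ`. -/
def maxExpectedLength {n p : ℕ} (C : ConfInterval n p) (Θ : Set (Param p)) : ENNReal :=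
  ⨆ θ ∈ Θ, expectedLength C θ

/-- The benchmark `L*_α(Θ₁, Θ, T)`: the infimum of the maximum expected length over `Θ₁` among all
confidence intervals for `T` of level `1 - α` over `Θ`. -/
def benchmark (n : ℕ) {p : ℕ} (α : ℝ) (Θ₁ Θ : Set (Param p)) (T : Param p → ℝ) : ENNReal :=
  ⨅ C ∈ levelIntervals n α Θ T, maxExpectedLength C Θ₁

/-- `Θ(k, I, σ₀)`: the `k`-sparse regression vectors with known `Ω = I` and `σ = σ₀`. -/
def knownSpace (p k : ℕ) (σ₀ : ℝ) : Set (Param p) :=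
  {θ | hammingNorm θ.beta ≤ k ∧ θ.Omega = 1 ∧ θ.sigma = σ₀}

/-- The linear functional `ξᵀ β`. -/
def linFunctional {p : ℕ} (ξ : Fin p → ℝ) (θ : Param p) : ℝ :=
  ∑ j, ξ j * θ.beta j

/-- `Ξ(q, c̄)`: the nonzero loadings with exactly `q` nonzero entries, whose absolute values have
pairwise ratios at most `c̄` (that is, the largest over the smallest one is at most `c̄`). -/
def loadings (p q : ℕ) (cbar : ℝ) : Set (Fin p → ℝ) :=
  {ξ | hammingNorm ξ = q ∧ ξ ≠ 0 ∧
    ∀ i j, ξ i ≠ 0 → ξ j ≠ 0 → |ξ i| / |ξ j| ≤ cbar}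

end HDLinReg

end

namespace HDLinReg
open scoped ENNReal NNReal

/-! An honest interval covers `T` under every parameter, hence also on average over a prior. Suppose
a prior on `Θ₁` with `T ≤ 0` and a prior on `Θ` with `T ≥ s` both give data laws within `ε` in total
variation of one reference measure. Then for some parameter in `Θ₁` the interval contains `[0, s]`
with probability at least `1 - 2α - 3ε`, which bounds its expected length (`le_maxExpectedLength`).
The reference makes the response `N(0, t)` independent of the design, and closeness follows from a
chi-square bound (`abs_mixture_sub_le`).

The priors pick one coordinate uniformly in each of `κ` disjoint blocks of size `m` inside the
support of `ξ`, with a fixed squared amplitude `x` and signs tied to those of `ξ`. Two draws have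
inner product `J x`, where `J` counts the blocks on which they agree. With `K = κ x` the energy, the
second moment per row is `t / √((2t - σ² - K - Jx)(σ² + K - Jx))`
(`lintegral_likRatio_mul_likRatio`). Since `J` is binomial with success probability `1/m`, averaging
`exp (l J)` costs only `κ (exp l - 1) / m` in the exponent. This is small because `m ≈ q / k` and
`q` exceeds `k²` by a power of `p`.

Two choices of `t` give the two terms of the maximum. With `t = σ²` and `β = 0` against a mixture,
the added energy shows in the variance of `y` and costs `n (K / σ²)²`; this limits the signal to the
minimum term. With `t = σ² + K` and two mixtures of equal energy, one on `k₁` coordinates and one on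
`k`, the variance reveals nothing and a separation of order `√(k k₁) √(log p / n)` remains
undetected. -/

/-! ### Gaussian integrals. -/

lemma lintegral_exp_neg_mul_sub_sq {b : ℝ} (hb : 0 < b) (m : ℝ) :
    ∫⁻ y, ENNReal.ofReal (Real.exp (-b * (y - m) ^ 2)) = ENNReal.ofReal (√(Real.pi / b)) := by
  have h := integral_gaussian b
  rw [← integral_sub_right_eq_self _ m] at h
  rw [← h, ofReal_integral_eq_lintegral_ofReal]
  · exact (integrable_exp_neg_mul_sq hb).comp_sub_right m
  · exact Filter.Eventually.of_forall fun _ => (Real.exp_pos _).le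

lemma lintegral_exp_sq_gaussianReal {s θ : ℝ} (hs : 0 ≤ s) (h : 2 * θ * s < 1) :
    ∫⁻ x, ENNReal.ofReal (Real.exp (θ * x ^ 2)) ∂(gaussianReal 0 s.toNNReal) =
      ENNReal.ofReal (1 / √(1 - 2 * θ * s)) := by
  rcases hs.eq_or_lt with rfl | hs
  · simp
  have hs' : s.toNNReal ≠ 0 := by simpa using hs
  rw [gaussianReal_of_var_ne_zero _ hs',
    lintegral_withDensity_eq_lintegral_mul _ (measurable_gaussianPDF _ _) (by fun_prop)]
  have hb : 0 < (1 - 2 * θ * s) / (2 * s) := div_pos (by linarith) (by positivity)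
  have key : ∀ x : ℝ, (gaussianPDF 0 s.toNNReal * fun x ↦ ENNReal.ofReal (Real.exp (θ * x ^ 2))) x
      = ENNReal.ofReal (√(2 * Real.pi * s))⁻¹ *
        ENNReal.ofReal (Real.exp (-((1 - 2 * θ * s) / (2 * s)) * (x - 0) ^ 2)) := by
    intro x
    simp only [Pi.mul_apply, gaussianPDF, gaussianPDFReal, Real.coe_toNNReal _ hs.le]
    rw [← ENNReal.ofReal_mul (by positivity), ← ENNReal.ofReal_mul (by positivity), mul_assoc,
      ← Real.exp_add]
    congr 3
    field_simp
    ring_nf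
  simp_rw [key]
  rw [lintegral_const_mul _ (by fun_prop), lintegral_exp_neg_mul_sub_sq hb,
    ← ENNReal.ofReal_mul (by positivity)]
  congr 1
  rw [← Real.sqrt_inv, ← Real.sqrt_mul (by positivity), ← Real.sqrt_one, ← Real.sqrt_div (by simp),
    Real.sqrt_one]
  congr 1
  have := Real.pi_pos
  have : 1 - 2 * θ * s ≠ 0 := by linarith
  field_simp

section stdGaussian

variable {E : Type*} [NormedAddCommGroup E] [InnerProductSpace ℝ E] [FiniteDimensional ℝ E]
  [MeasurableSpace E] [BorelSpace E]

lemma stdGaussian_map_inner (u : E) :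
    (stdGaussian E).map (fun x => inner ℝ u x) = gaussianReal 0 (‖u‖ ^ 2).toNNReal := by
  have h := IsGaussian.map_eq_gaussianReal (μ := stdGaussian E) (innerSL ℝ u)
  rw [variance_dual_stdGaussian, integral_strongDual_stdGaussian, innerSL_apply_norm] at h
  exact h

lemma indepFun_inner_stdGaussian {u w : E} (h : inner ℝ u w = (0 : ℝ)) :
    IndepFun (fun x => inner ℝ u x) (fun x => inner ℝ w x) (stdGaussian E) := by
  apply HasGaussianLaw.indepFun_of_covariance_eq_zero
  · exact (IsGaussian.hasGaussianLaw_id (μ := stdGaussian E)).map_fun ((innerSL ℝ u).prod (innerSL ℝ w))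
  · rw [← covarianceBilin_apply_eq_cov, covarianceBilin_stdGaussian]
    · exact h
    · exact IsGaussian.memLp_two_id

lemma lintegral_exp_sq_add_sq_stdGaussian {u w : E} (h : inner ℝ u w = (0 : ℝ)) {θ η : ℝ}
    (hθ : 2 * θ * ‖u‖ ^ 2 < 1) (hη : 2 * η * ‖w‖ ^ 2 < 1) :
    ∫⁻ x, ENNReal.ofReal (Real.exp (θ * inner ℝ u x ^ 2 + η * inner ℝ w x ^ 2)) ∂(stdGaussian E) =
      ENNReal.ofReal (1 / √(1 - 2 * θ * ‖u‖ ^ 2) * (1 / √(1 - 2 * η * ‖w‖ ^ 2))) := by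
  have hi := (indepFun_inner_stdGaussian h).comp
    (φ := fun z : ℝ => ENNReal.ofReal (Real.exp (θ * z ^ 2)))
    (ψ := fun z : ℝ => ENNReal.ofReal (Real.exp (η * z ^ 2))) (by fun_prop) (by fun_prop)
  have hm : ∀ u : E, Measurable fun x : E => inner ℝ u x := fun u => (innerSL ℝ u).measurable
  have hf : ∀ (θ : ℝ) (u : E), 2 * θ * ‖u‖ ^ 2 < 1 →
      ∫⁻ x, ENNReal.ofReal (Real.exp (θ * inner ℝ u x ^ 2)) ∂(stdGaussian E) =
        ENNReal.ofReal (1 / √(1 - 2 * θ * ‖u‖ ^ 2)) := by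
    intro θ u hθ
    rw [← lintegral_exp_sq_gaussianReal (sq_nonneg _) hθ, ← stdGaussian_map_inner,
      lintegral_map (by fun_prop) (hm u)]
  have := lintegral_mul_eq_lintegral_mul_lintegral_of_indepFun'' (μ := stdGaussian E)
    (f := (fun z : ℝ => ENNReal.ofReal (Real.exp (θ * z ^ 2))) ∘ fun x => inner ℝ u x)
    (g := (fun z : ℝ => ENNReal.ofReal (Real.exp (η * z ^ 2))) ∘ fun x => inner ℝ w x)
    (Measurable.aemeasurable ((by fun_prop : Measurable fun z : ℝ => ENNReal.ofReal (Real.exp (θ * z ^ 2))).comp (hm u)))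
    (Measurable.aemeasurable ((by fun_prop : Measurable fun z : ℝ => ENNReal.ofReal (Real.exp (η * z ^ 2))).comp (hm w))) hi
  simp only [Function.comp_apply] at this
  simp_rw [Real.exp_add]
  rw [ENNReal.ofReal_mul (by positivity), ← hf θ u hθ, ← hf η w hη, ← this]
  refine lintegral_congr fun x => ?_
  rw [ENNReal.ofReal_mul (by positivity)]

end stdGaussian

/-! ### Likelihood ratios against an independent response. -/

/-- The law of one observation when the response `N(0, t)` is independent of the design. -/
noncomputable def nullRowLaw (p : ℕ) (t : ℝ) : Measure (ℝ × EuclideanSpace ℝ (Fin p)) :=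
  (gaussianReal 0 t.toNNReal).prod (stdGaussian (EuclideanSpace ℝ (Fin p)))

instance (p : ℕ) (t : ℝ) : IsProbabilityMeasure (nullRowLaw p t) := by
  unfold nullRowLaw; infer_instance

/-- The density of one observation with regression vector `b` and noise variance `v` with respect
to `nullRowLaw p t`. -/
noncomputable def likRatio {p : ℕ} (v t : ℝ) (b : EuclideanSpace ℝ (Fin p))
    (w : ℝ × EuclideanSpace ℝ (Fin p)) : ℝ :=
  gaussianPDFReal (inner ℝ b w.2) v.toNNReal w.1 / gaussianPDFReal 0 t.toNNReal w.1

lemma likRatio_nonneg {p : ℕ} (v t : ℝ) (b : EuclideanSpace ℝ (Fin p)) (w) :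
    0 ≤ likRatio v t b w :=
  div_nonneg (gaussianPDFReal_nonneg _ _ _) (gaussianPDFReal_nonneg _ _ _)

@[fun_prop]
lemma measurable_likRatio {p : ℕ} (v t : ℝ) (b : EuclideanSpace ℝ (Fin p)) :
    Measurable (likRatio v t b) := by
  unfold likRatio
  simp only [gaussianPDFReal_def]
  fun_prop

lemma likRatio_mul_gaussianPDF {p : ℕ} (v : ℝ) {t : ℝ} (ht : 0 < t) (b : EuclideanSpace ℝ (Fin p))
    (y : ℝ) (x : EuclideanSpace ℝ (Fin p)) :
    gaussianPDF 0 t.toNNReal y * ENNReal.ofReal (likRatio v t b (y, x)) =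
      gaussianPDF (inner ℝ b x) v.toNNReal y := by
  have := gaussianPDFReal_pos 0 t.toNNReal y (by simpa using ht)
  rw [gaussianPDF, gaussianPDF, ← ENNReal.ofReal_mul this.le, likRatio]
  congr 1
  field_simp

lemma lintegral_nullRowLaw {p : ℕ} {t : ℝ} (ht : 0 < t)
    {f : ℝ × EuclideanSpace ℝ (Fin p) → ℝ≥0∞} (hf : Measurable f) :
    ∫⁻ w, f w ∂(nullRowLaw p t) =
      ∫⁻ x, (∫⁻ y, gaussianPDF 0 t.toNNReal y * f (y, x))
        ∂(stdGaussian (EuclideanSpace ℝ (Fin p))) := by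
  rw [nullRowLaw, lintegral_prod_symm _ hf.aemeasurable]
  refine lintegral_congr fun x => ?_
  rw [gaussianReal_of_var_ne_zero _ (by simpa using ht),
    lintegral_withDensity_eq_lintegral_mul _ (measurable_gaussianPDF _ _) (by fun_prop)]
  rfl

lemma rowLaw_eq_withDensity {p : ℕ} {θ : Param p} (hΩ : θ.Omega = 1) (hσ : 0 < θ.sigma)
    {t : ℝ} (ht : 0 < t) :
    rowLaw θ = (nullRowLaw p t).withDensity
      (fun w => ENNReal.ofReal (likRatio (θ.sigma ^ 2) t (WithLp.toLp 2 θ.beta) w)) := by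
  have hv : (θ.sigma ^ 2).toNNReal ≠ 0 := by simpa using hσ.ne'
  have hm : ∀ x : EuclideanSpace ℝ (Fin p),
      ∑ j, x j * θ.beta j = inner ℝ (WithLp.toLp 2 θ.beta) x := fun x => by
    simp [PiLp.inner_apply]
  ext s hs
  rw [rowLaw, hΩ, inv_one, multivariateGaussian_zero_one, withDensity_apply _ hs,
    ← lintegral_indicator hs, lintegral_nullRowLaw ht (Measurable.indicator (by fun_prop) hs),
    Measure.map_apply (by fun_prop) hs,
    Measure.prod_apply (hs.preimage (by fun_prop))]
  refine lintegral_congr fun x => ?_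
  have hs' : MeasurableSet ((fun y => (y, x)) ⁻¹' s) := hs.preimage (by fun_prop)
  have e : (Prod.mk x ⁻¹' ((fun w : EuclideanSpace ℝ (Fin p) × ℝ =>
      ((∑ j, w.1 j * θ.beta j) + w.2, w.1)) ⁻¹' s)) =
      (fun e => (inner ℝ (WithLp.toLp 2 θ.beta) x) + e) ⁻¹' ((fun y => (y, x)) ⁻¹' s) := by
    ext e
    simp [hm]
  rw [e, ← Measure.map_apply (by fun_prop) hs', gaussianReal_map_const_add, zero_add,
    gaussianReal_apply _ hv, ← lintegral_indicator hs']
  refine lintegral_congr fun y => ?_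
  by_cases h : (y, x) ∈ s <;> simp [Set.indicator, h, likRatio_mul_gaussianPDF _ ht]

/-- Completing the square in `y`; convergence needs `v < 2t`. The exponent is split along `u + w`
and `u - w` because these become independent once the design is averaged. -/
lemma lintegral_gaussianPDFReal_mul_div {v t : ℝ} (hv : 0 < v) (ht : 0 < t) (h : v < 2 * t)
    (u w : ℝ) :
    ∫⁻ y, ENNReal.ofReal (gaussianPDFReal u v.toNNReal y * gaussianPDFReal w v.toNNReal y /
      gaussianPDFReal 0 t.toNNReal y) =
      ENNReal.ofReal (t / √(v * (2 * t - v))) * ENNReal.ofReal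
        (Real.exp (1 / (4 * (2 * t - v)) * (u + w) ^ 2 + -1 / (4 * v) * (u - w) ^ 2)) := by
  have hd : 0 < 2 * t - v := by linarith
  have hπ := Real.pi_pos
  have hb : 0 < (2 * t - v) / (2 * t * v) := by positivity
  have key : ∀ y : ℝ, gaussianPDFReal u v.toNNReal y * gaussianPDFReal w v.toNNReal y /
      gaussianPDFReal 0 t.toNNReal y =
      (√(2 * Real.pi * t) / (2 * Real.pi * v) * Real.exp (1 / (4 * (2 * t - v)) * (u + w) ^ 2 +
        -1 / (4 * v) * (u - w) ^ 2)) *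
      Real.exp (-((2 * t - v) / (2 * t * v)) * (y - t * (u + w) / (2 * t - v)) ^ 2) := by
    intro y
    simp only [gaussianPDFReal, Real.coe_toNNReal _ hv.le, Real.coe_toNNReal _ ht.le]
    have h1 : √(2 * Real.pi * v) * √(2 * Real.pi * v) = 2 * Real.pi * v :=
      Real.mul_self_sqrt (by positivity)
    have h2 : 0 < √(2 * Real.pi * t) := by positivity
    have h3 : 0 < √(2 * Real.pi * v) := by positivity
    rw [mul_assoc (√(2 * Real.pi * t) / (2 * Real.pi * v)), ← Real.exp_add,
      div_eq_iff (by positivity)]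
    have : Real.exp (-(y - u) ^ 2 / (2 * v)) * Real.exp (-(y - w) ^ 2 / (2 * v)) =
        Real.exp (1 / (4 * (2 * t - v)) * (u + w) ^ 2 + -1 / (4 * v) * (u - w) ^ 2 +
          -((2 * t - v) / (2 * t * v)) * (y - t * (u + w) / (2 * t - v)) ^ 2) *
        Real.exp (-(y - 0) ^ 2 / (2 * t)) := by
      rw [← Real.exp_add, ← Real.exp_add]
      congr 1
      field_simp
      ring
    calc _ = (√(2 * Real.pi * v))⁻¹ * (√(2 * Real.pi * v))⁻¹ *
          (Real.exp (-(y - u) ^ 2 / (2 * v)) * Real.exp (-(y - w) ^ 2 / (2 * v))) := by ring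
      _ = _ := by
        rw [this, ← mul_inv, h1]
        field_simp
  simp_rw [key]
  simp_rw [ENNReal.ofReal_mul (show 0 ≤ √(2 * Real.pi * t) / (2 * Real.pi * v) * Real.exp
    (1 / (4 * (2 * t - v)) * (u + w) ^ 2 + -1 / (4 * v) * (u - w) ^ 2) by positivity)]
  rw [lintegral_const_mul _ (by fun_prop), lintegral_exp_neg_mul_sub_sq hb,
    ← ENNReal.ofReal_mul (by positivity), ← ENNReal.ofReal_mul (by positivity),
    mul_right_comm]
  congr 2
  have e : √(2 * Real.pi * t) * √(Real.pi / ((2 * t - v) / (2 * t * v))) =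
      2 * Real.pi * v * t / √(v * (2 * t - v)) := by
    rw [← Real.sqrt_mul (by positivity), eq_div_iff (by positivity),
      ← Real.sqrt_mul (by positivity), Real.sqrt_eq_iff_mul_self_eq (by positivity) (by positivity)]
    field_simp
  rw [div_mul_eq_mul_div, e]
  field_simp

/-- The second moment of two likelihood ratios whose regression vectors have equal norms. -/
lemma lintegral_likRatio_mul_likRatio {p : ℕ} {v t K : ℝ} (hv : 0 < v) (ht : 0 < t)
    {a b : EuclideanSpace ℝ (Fin p)} (ha : ‖a‖ ^ 2 = K) (hb : ‖b‖ ^ 2 = K)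
    (h : v + K + inner ℝ a b < 2 * t) :
    ∫⁻ w, ENNReal.ofReal (likRatio v t a w) * ENNReal.ofReal (likRatio v t b w)
        ∂(nullRowLaw p t) =
      ENNReal.ofReal (t / √((2 * t - v - K - inner ℝ a b) * (v + K - inner ℝ a b))) := by
  have hab := real_inner_le_norm a b
  have hab' := neg_le_of_abs_le (abs_real_inner_le_norm a b)
  have hK : inner ℝ a b ≤ K := by nlinarith [sq_nonneg (‖a‖ - ‖b‖)]
  have hK' : -K ≤ inner ℝ a b := by nlinarith [sq_nonneg (‖a‖ - ‖b‖)]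
  set J : ℝ := inner ℝ a b with hJ
  have hd : v < 2 * t := by linarith
  have hd' : 0 < 2 * t - v := by linarith
  have hplus : ‖a + b‖ ^ 2 = 2 * (K + J) := by
    rw [@norm_add_sq_real, ha, hb]; ring
  have hminus : ‖a - b‖ ^ 2 = 2 * (K - J) := by
    rw [@norm_sub_sq_real, ha, hb]; ring
  -- Equal norms make `a + b` and `a - b` orthogonal, so the Gaussian expectation over the design
  -- factors.
  have horth : inner ℝ (a + b) (a - b) = (0 : ℝ) := by
    rw [inner_add_left, inner_sub_right, inner_sub_right, real_inner_self_eq_norm_sq,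
      real_inner_self_eq_norm_sq, real_inner_comm a b, ha, hb]; ring
  rw [lintegral_nullRowLaw ht (by fun_prop)]
  have inn : ∀ x : EuclideanSpace ℝ (Fin p), ∫⁻ y, gaussianPDF 0 t.toNNReal y *
      (ENNReal.ofReal (likRatio v t a (y, x)) * ENNReal.ofReal (likRatio v t b (y, x))) =
      ENNReal.ofReal (t / √(v * (2 * t - v))) * ENNReal.ofReal
        (Real.exp (1 / (4 * (2 * t - v)) * inner ℝ (a + b) x ^ 2 +
          -1 / (4 * v) * inner ℝ (a - b) x ^ 2)) := by
    intro x
    rw [inner_add_left, inner_sub_left, ← lintegral_gaussianPDFReal_mul_div hv ht hd]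
    refine lintegral_congr fun y => ?_
    rw [← mul_assoc, likRatio_mul_gaussianPDF _ ht, gaussianPDF,
      ← ENNReal.ofReal_mul (gaussianPDFReal_nonneg _ _ _), likRatio, mul_div_assoc]
  simp_rw [inn]
  have c1 : 2 * (1 / (4 * (2 * t - v))) * ‖a + b‖ ^ 2 < 1 := by
    rw [hplus, show 2 * (1 / (4 * (2 * t - v))) * (2 * (K + J)) = (K + J) / (2 * t - v) by
      field_simp; ring, div_lt_one hd']
    linarith
  have c2 : 2 * (-1 / (4 * v)) * ‖a - b‖ ^ 2 < 1 := by
    rw [hminus, show 2 * (-1 / (4 * v)) * (2 * (K - J)) = -((K - J) / v) by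
      field_simp; ring]
    have : 0 ≤ (K - J) / v := div_nonneg (by linarith) hv.le
    linarith
  rw [lintegral_const_mul _ (by fun_prop), lintegral_exp_sq_add_sq_stdGaussian horth c1 c2,
    ← ENNReal.ofReal_mul (by positivity)]
  congr 1
  rw [hplus, hminus]
  have p1 : 0 < 2 * t - v - K - J := by linarith
  have p2 : 0 < v + K - J := by linarith
  have e1 : 1 - 2 * (1 / (4 * (2 * t - v))) * (2 * (K + J)) =
      (2 * t - v - K - J) / (2 * t - v) := by field_simp; ring
  have e2 : 1 - 2 * (-1 / (4 * v)) * (2 * (K - J)) = (v + K - J) / v := by field_simp; ring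
  rw [e1, e2, Real.sqrt_div p1.le, Real.sqrt_div p2.le, Real.sqrt_mul p1.le, Real.sqrt_mul hv.le]
  have : 0 < √(2 * t - v) := by positivity
  have : 0 < √v := by positivity
  have : 0 < √(2 * t - v - K - J) := by positivity
  have : 0 < √(v + K - J) := by positivity
  generalize √(2 * t - v) = r at *
  field_simp

/-! ### Product densities and total variation of mixtures. -/

lemma lintegral_pi_prod {ι Ω : Type*} [Fintype ι] [MeasurableSpace Ω] (Q : Measure Ω)
    [IsProbabilityMeasure Q] {f : ι → Ω → ℝ≥0∞} (hf : ∀ i, Measurable (f i)) :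
    ∫⁻ z, ∏ i, f i (z i) ∂(Measure.pi fun _ : ι => Q) = ∏ i, ∫⁻ x, f i x ∂Q := by
  have hi := iIndepFun_pi (μ := fun _ : ι => Q) (X := f) fun i => (hf i).aemeasurable
  rw [lintegral_prod_eq_prod_lintegral_of_indepFun Finset.univ (fun i (z : ι → Ω) => f i (z i)) hi
    fun i => (hf i).comp (measurable_pi_apply i)]
  refine Finset.prod_congr rfl fun i _ => ?_
  exact (measurePreserving_eval (fun _ : ι => Q) i).lintegral_comp (hf i)

lemma pi_withDensity {ι Ω : Type*} [Fintype ι] [MeasurableSpace Ω] (Q : Measure Ω)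
    [IsProbabilityMeasure Q] {f : Ω → ℝ≥0∞} (hf : Measurable f)
    [IsProbabilityMeasure (Q.withDensity f)] :
    Measure.pi (fun _ : ι => Q.withDensity f) =
      (Measure.pi fun _ : ι => Q).withDensity fun z => ∏ i, f (z i) := by
  refine Measure.pi_eq fun s hs => ?_
  rw [withDensity_apply _ (MeasurableSet.univ_pi hs),
    ← lintegral_indicator (MeasurableSet.univ_pi hs)]
  have h1 : ∀ i, Q.withDensity f (s i) = ∫⁻ x, (s i).indicator f x ∂Q := fun i => by
    rw [withDensity_apply f (hs i), lintegral_indicator (hs i)]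
  rw [Finset.prod_congr rfl fun i _ => h1 i, ← lintegral_pi_prod Q fun i => hf.indicator (hs i)]
  refine lintegral_congr fun z => ?_
  by_cases h : z ∈ Set.pi Set.univ s
  · rw [Set.indicator_of_mem h]
    exact Finset.prod_congr rfl fun i _ => by rw [Set.indicator_of_mem (h i (Set.mem_univ i))]
  · rw [Set.indicator_of_notMem h]
    obtain ⟨i, hi⟩ : ∃ i, z i ∉ s i := by simpa [Set.mem_pi] using h
    exact (Finset.prod_eq_zero (Finset.mem_univ i) (Set.indicator_of_notMem hi _)).symm

/-- A mixture whose second moment with respect to `μ` is at most `1 + ε ^ 2` is within `ε` of `μ`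
in total variation. -/
lemma abs_mixture_sub_le {Ω A : Type*} [MeasurableSpace Ω] [Fintype A] [Nonempty A]
    (μ : Measure Ω) [IsProbabilityMeasure μ] {g : A → Ω → ℝ} (hg : ∀ a, Measurable (g a))
    (hg0 : ∀ a z, 0 ≤ g a z) {P : A → Measure Ω} [∀ a, IsProbabilityMeasure (P a)]
    (hP : ∀ a, P a = μ.withDensity fun z => ENNReal.ofReal (g a z)) {r : A → A → ℝ}
    (hr : ∀ a b, ∫⁻ z, ENNReal.ofReal (g a z) * ENNReal.ofReal (g b z) ∂μ ≤ ENNReal.ofReal (r a b))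
    (hr0 : ∀ a b, 0 ≤ r a b)
    {ε : ℝ} (hε : 0 < ε) (h : ∑ a, ∑ b, r a b ≤ (1 + ε ^ 2) * (Fintype.card A : ℝ) ^ 2)
    {E : Set Ω} (hE : MeasurableSet E) :
    |(∑ a, (P a).real E) / Fintype.card A - μ.real E| ≤ ε := by
  have hN : (0 : ℝ) < Fintype.card A := by exact_mod_cast Fintype.card_pos
  set N : ℝ := (Fintype.card A : ℝ)
  have hint : ∀ a, Integrable (g a) μ := fun a => by
    refine ⟨(hg a).aestronglyMeasurable, ?_⟩
    rw [hasFiniteIntegral_iff_ofReal (Filter.Eventually.of_forall (hg0 a))]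
    have := measure_lt_top (P a) Set.univ
    rwa [hP, withDensity_apply _ MeasurableSet.univ, Measure.restrict_univ] at this
  have hreal : ∀ a (F : Set Ω), MeasurableSet F → (P a).real F = ∫ z in F, g a z ∂μ := by
    intro a F hF
    rw [integral_eq_lintegral_of_nonneg_ae (Filter.Eventually.of_forall (hg0 a))
      (hg a).aestronglyMeasurable, Measure.real, hP, withDensity_apply _ hF]
  have hint1 : ∀ a, ∫ z, g a z ∂μ = 1 := fun a => by
    rw [← setIntegral_univ, ← hreal a _ MeasurableSet.univ]
    simp
  have hmul : ∀ a b, Integrable (fun z => g a z * g b z) μ ∧ ∫ z, g a z * g b z ∂μ ≤ r a b := by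
    intro a b
    have hab := hr a b
    simp_rw [fun z => (ENNReal.ofReal_mul (q := g b z) (hg0 a z)).symm] at hab
    have h0 : 0 ≤ᵐ[μ] fun z => g a z * g b z :=
      Filter.Eventually.of_forall fun z => mul_nonneg (hg0 a z) (hg0 b z)
    constructor
    · refine ⟨((hg a).mul (hg b)).aestronglyMeasurable, ?_⟩
      rw [hasFiniteIntegral_iff_ofReal h0]
      exact hab.trans_lt ENNReal.ofReal_lt_top
    · rw [integral_eq_lintegral_of_nonneg_ae h0 ((hg a).mul (hg b)).aestronglyMeasurable]
      exact ENNReal.toReal_le_of_le_ofReal (hr0 a b) hab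
  set M : Ω → ℝ := fun z => (∑ a, g a z) / N with hM
  have hMint : Integrable M μ := (integrable_finsetSum _ fun a _ => hint a).div_const _
  have hM1 : ∫ z, M z ∂μ = 1 := by
    rw [hM, integral_div, integral_finsetSum _ fun a _ => hint a]
    simp [hint1, N]
  have hMsq : (fun z => M z ^ 2) = fun z => (∑ a, ∑ b, g a z * g b z) / N ^ 2 := by
    ext z
    rw [hM, div_pow, sq (∑ a, g a z), Finset.sum_mul_sum]
  have hM2int : Integrable (fun z => M z ^ 2) μ := by
    rw [hMsq]
    exact (integrable_finsetSum _ fun a _ => integrable_finsetSum _ fun b _ =>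
      (hmul a b).1).div_const _
  have hM2 : ∫ z, M z ^ 2 ∂μ ≤ 1 + ε ^ 2 := by
    rw [hMsq, integral_div, integral_finsetSum _ fun a _ => integrable_finsetSum _ fun b _ =>
      (hmul a b).1, div_le_iff₀ (by positivity)]
    refine le_trans (Finset.sum_le_sum fun a _ => ?_) h
    rw [integral_finsetSum _ fun b _ => (hmul a b).1]
    exact Finset.sum_le_sum fun b _ => (hmul a b).2
  have hdiff : (∑ a, (P a).real E) / N - μ.real E = ∫ z in E, (M z - 1) ∂μ := by
    rw [integral_sub hMint.integrableOn (integrable_const _), hM, integral_div,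
      integral_finsetSum _ fun a _ => (hint a).integrableOn]
    simp [hreal _ E hE]
  have hquad : Integrable (fun z => (ε ^ 2 + 1) / (2 * ε) + M z ^ 2 / (2 * ε)) μ :=
    (integrable_const _).add (hM2int.div_const _)
  have hd := hMint.sub (integrable_const (1 : ℝ))
  rw [hdiff]
  calc |∫ z in E, (M z - 1) ∂μ| ≤ ∫ z in E, |M z - 1| ∂μ := abs_integral_le_integral_abs
    _ ≤ ∫ z, |M z - 1| ∂μ := setIntegral_le_integral hd.abs
        (Filter.Eventually.of_forall fun z => abs_nonneg _)
    -- The pointwise bound `|M - 1| ≤ (ε² + |M - 1|²) / (2ε)` takes the place of Cauchy–Schwarz.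
    _ ≤ ∫ z, ((ε ^ 2 + 1) / (2 * ε) + M z ^ 2 / (2 * ε) - M z / ε) ∂μ := by
        refine integral_mono hd.abs (hquad.sub (hMint.div_const _)) fun z => ?_
        have h1 : (ε ^ 2 + 1) / (2 * ε) + M z ^ 2 / (2 * ε) - M z / ε =
            (ε ^ 2 + |M z - 1| ^ 2) / (2 * ε) := by
          rw [sq_abs]; field_simp; ring
        simp only [h1]
        rw [le_div_iff₀ (by positivity)]
        nlinarith [sq_nonneg (ε - |M z - 1|)]
    _ = (ε ^ 2 + 1) / (2 * ε) + (∫ z, M z ^ 2 ∂μ) / (2 * ε) - 1 / ε := by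
        rw [integral_sub hquad (hMint.div_const _),
          integral_add (integrable_const _) (hM2int.div_const _), integral_const,
          integral_div, integral_div, hM1]
        simp
    _ ≤ (ε ^ 2 + 1) / (2 * ε) + (1 + ε ^ 2) / (2 * ε) - 1 / ε := by gcongr
    _ = ε := by field_simp; ring

/-! ### From two close mixtures to interval length. -/

instance {p : ℕ} (θ : Param p) : IsProbabilityMeasure (rowLaw θ) := by
  unfold rowLaw
  exact Measure.isProbabilityMeasure_map (Measurable.aemeasurable (by fun_prop))

instance {n p : ℕ} (θ : Param p) : IsProbabilityMeasure (law n θ) := by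
  unfold law; infer_instance

lemma le_average {A : Type*} [Fintype A] [Nonempty A] {f : A → ℝ} {x : ℝ} (hx : ∀ a, x ≤ f a) :
    x ≤ (∑ a, f a) / Fintype.card A := by
  rw [le_div_iff₀ (by exact_mod_cast Fintype.card_pos)]
  have := Finset.card_nsmul_le_sum Finset.univ _ x fun a _ => hx a
  simpa [mul_comm] using this

/-- If a mixture of laws with `T ≤ 0` and a mixture of laws with `T ≥ s` are both close to one
measure, then every honest confidence interval has expected length of order `s`. -/
lemma le_maxExpectedLength {n p : ℕ} {α : ℝ} {Θ₁ Θ : Set (Param p)} {T : Param p → ℝ}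
    {C : ConfInterval n p} (hC : C ∈ levelIntervals n α Θ T) (hΘ : Θ₁ ⊆ Θ)
    {A₀ A₁ : Type*} [Fintype A₀] [Nonempty A₀] [Fintype A₁] [Nonempty A₁]
    {θ₀ : A₀ → Param p} {θ₁ : A₁ → Param p} (h₀ : ∀ a, θ₀ a ∈ Θ₁) (h₁ : ∀ a, θ₁ a ∈ Θ)
    {s : ℝ} (hs : 0 ≤ s) (hT₀ : ∀ a, T (θ₀ a) ≤ 0) (hT₁ : ∀ a, s ≤ T (θ₁ a))
    (μ : Measure (Data n p)) [IsProbabilityMeasure μ] {ε : ℝ}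
    (hμ₀ : ∀ E, MeasurableSet E →
      |(∑ a, (law n (θ₀ a)).real E) / Fintype.card A₀ - μ.real E| ≤ ε)
    (hμ₁ : ∀ E, MeasurableSet E →
      |(∑ a, (law n (θ₁ a)).real E) / Fintype.card A₁ - μ.real E| ≤ ε) :
    ENNReal.ofReal (s * (1 - 2 * α - 3 * ε)) ≤ maxExpectedLength C Θ₁ := by
  have hcov : ∀ θ ∈ Θ, 1 - α ≤ (law n θ).real {z | C.lower z ≤ T θ ∧ T θ ≤ C.upper z} := by
    intro θ hθ
    rw [levelIntervals, Set.mem_ofPred_eq] at hC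
    have := hC.trans (iInf₂_le θ hθ)
    exact (ENNReal.ofReal_le_iff_le_toReal (measure_ne_top _ _)).1 this
  set El : Set (Data n p) := {z | C.lower z ≤ 0} with hEl
  set Eu : Set (Data n p) := {z | s ≤ C.upper z} with hEu
  have mEl : MeasurableSet El := measurableSet_le C.measurable_lower measurable_const
  have mEu : MeasurableSet Eu := measurableSet_le measurable_const C.measurable_upper
  have hl : 1 - α ≤ (∑ a, (law n (θ₀ a)).real El) / Fintype.card A₀ := le_average fun a =>
    (hcov _ (hΘ (h₀ a))).trans (measureReal_mono fun z hz => hz.1.trans (hT₀ a))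
  have hu : 1 - α ≤ (∑ a, (law n (θ₁ a)).real Eu) / Fintype.card A₁ := le_average fun a =>
    (hcov _ (h₁ a)).trans (measureReal_mono fun z hz => (hT₁ a).trans hz.2)
  have i1 := abs_le.1 (hμ₀ El mEl)
  have i2 := abs_le.1 (hμ₁ Eu mEu)
  have i3 := abs_le.1 (hμ₀ (El ∩ Eu) (mEl.inter mEu))
  -- Moving `El` and `Eu` to `μ` costs `ε` each; moving their intersection back to the first mixture
  -- costs the third `ε`.
  have i4 : μ.real El + μ.real Eu - 1 ≤ μ.real (El ∩ Eu) := by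
    have := measureReal_union_add_inter (μ := μ) (s := El) mEu
    have h1 : μ.real (El ∪ Eu) ≤ 1 := measureReal_le_one
    linarith
  obtain ⟨a, -, ha⟩ : ∃ a ∈ Finset.univ, 1 - 2 * α - 3 * ε ≤ (law n (θ₀ a)).real (El ∩ Eu) := by
    refine Finset.exists_le_of_sum_le Finset.univ_nonempty ?_
    have hN : (0 : ℝ) < Fintype.card A₀ := by exact_mod_cast Fintype.card_pos
    have : 1 - 2 * α - 3 * ε ≤ (∑ a, (law n (θ₀ a)).real (El ∩ Eu)) / Fintype.card A₀ := by
      linarith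
    rw [le_div_iff₀ hN] at this
    rw [Finset.sum_const, Finset.card_univ, nsmul_eq_mul]
    linarith
  calc ENNReal.ofReal (s * (1 - 2 * α - 3 * ε))
      ≤ ENNReal.ofReal (s * (law n (θ₀ a)).real (El ∩ Eu)) := by gcongr
    _ = ENNReal.ofReal s * law n (θ₀ a) (El ∩ Eu) := by
        rw [ENNReal.ofReal_mul hs, ofReal_measureReal]
    _ ≤ ENNReal.ofReal s * law n (θ₀ a)
          {z | ENNReal.ofReal s ≤ ENNReal.ofReal (C.upper z - C.lower z)} := by
        gcongr
        intro z hz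
        refine ENNReal.ofReal_le_ofReal ?_
        have h1 : C.lower z ≤ 0 := hz.1
        have h2 : s ≤ C.upper z := hz.2
        linarith
    _ ≤ expectedLength C (θ₀ a) := by
        refine mul_meas_ge_le_lintegral ?_ _
        exact (C.measurable_upper.sub C.measurable_lower).ennreal_ofReal
    _ ≤ maxExpectedLength C Θ₁ := le_iSup₂ (f := fun θ _ => expectedLength C θ) _ (h₀ a)

/-! ### Block-sparse vectors and their agreements. -/

/-- The vector that agrees with `w` at one coordinate `φ (i, f i)` of each block `i` and vanishes
elsewhere. -/
def blockVec {p κ m : ℕ} (φ : Fin κ × Fin m → Fin p) (w : Fin p → ℝ) (f : Fin κ → Fin m) :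
    Fin p → ℝ :=
  ∑ i, Pi.single (φ (i, f i)) (w (φ (i, f i)))

section blockVec

variable {p κ m : ℕ} (φ : Fin κ × Fin m → Fin p) (w : Fin p → ℝ)

lemma sum_mul_blockVec (u : Fin p → ℝ) (f : Fin κ → Fin m) :
    ∑ j, u j * blockVec φ w f j = ∑ i, u (φ (i, f i)) * w (φ (i, f i)) := by
  simp only [blockVec, Finset.sum_apply, Finset.mul_sum]
  rw [Finset.sum_comm]
  refine Finset.sum_congr rfl fun i _ => ?_
  simp [Pi.single_apply]

lemma hammingNorm_blockVec_le (f : Fin κ → Fin m) : hammingNorm (blockVec φ w f) ≤ κ := by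
  have h : (Finset.univ.filter fun j => blockVec φ w f j ≠ 0) ⊆
      Finset.univ.image fun i => φ (i, f i) := by
    intro j hj
    rw [Finset.mem_filter] at hj
    by_contra h
    refine hj.2 ?_
    simp only [Finset.mem_image, Finset.mem_univ, true_and, not_exists] at h
    rw [blockVec, Finset.sum_apply]
    exact Finset.sum_eq_zero fun i _ => Pi.single_eq_of_ne (fun e => h i e.symm) _
  calc hammingNorm (blockVec φ w f) ≤ (Finset.univ.image fun i => φ (i, f i)).card :=
        Finset.card_le_card h
    _ ≤ κ := Finset.card_image_le.trans (by simp)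

variable {φ}

lemma blockVec_apply (hφ : Function.Injective φ) (f : Fin κ → Fin m) (i : Fin κ) (a : Fin m) :
    blockVec φ w f (φ (i, a)) = if f i = a then w (φ (i, a)) else 0 := by
  rw [blockVec, Finset.sum_apply, Finset.sum_eq_single i]
  · by_cases h : f i = a
    · simp [h]
    · rw [if_neg h, Pi.single_eq_of_ne]
      intro e
      exact h (by simpa using (hφ e).symm)
  · intro b _ hb
    rw [Pi.single_eq_of_ne]
    intro e
    exact hb (by have := hφ e; simp at this; exact this.1.symm)
  · simp

lemma sum_blockVec_mul_blockVec (hφ : Function.Injective φ) {x : ℝ} {w : Fin p → ℝ}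
    (hw : ∀ z, w (φ z) ^ 2 = x) (f g : Fin κ → Fin m) :
    ∑ j, blockVec φ w f j * blockVec φ w g j =
      (Finset.univ.filter fun i => f i = g i).card * x := by
  rw [sum_mul_blockVec]
  simp_rw [blockVec_apply w hφ, ite_mul, zero_mul, ← sq, hw]
  rw [← Finset.sum_filter, Finset.sum_const, nsmul_eq_mul]

end blockVec

/-- Blocks are independent under the uniform choice, so the sum factors into `κ` copies of `m - 1 +
exp l`; then `1 + x ≤ exp x`. -/
lemma sum_exp_agreements_le {κ m : ℕ} (hm : 0 < m) (l : ℝ) (hl : 0 ≤ l) :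
    ∑ f : Fin κ → Fin m, ∑ g : Fin κ → Fin m,
      Real.exp (l * (Finset.univ.filter fun i => f i = g i).card) ≤
    Real.exp (κ * (Real.exp l - 1) / m) * ((m : ℝ) ^ κ) ^ 2 := by
  have hm' : (0 : ℝ) < m := by exact_mod_cast hm
  have h1 : ∀ f g : Fin κ → Fin m, Real.exp (l * (Finset.univ.filter fun i => f i = g i).card) =
      ∏ i, if f i = g i then Real.exp l else 1 := by
    intro f g
    rw [Finset.prod_ite, Finset.prod_const, Finset.prod_const_one, mul_one, ← Real.exp_nat_mul,
      mul_comm]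
  have h2 : ∀ f : Fin κ → Fin m, ∑ g : Fin κ → Fin m, ∏ i, (if f i = g i then Real.exp l else 1) =
      (m - 1 + Real.exp l) ^ κ := by
    intro f
    have := Finset.prod_univ_sum (fun _ : Fin κ => (Finset.univ : Finset (Fin m)))
      fun i a => if f i = a then Real.exp l else 1
    rw [Fintype.piFinset_univ] at this
    rw [← this]
    have h3 : ∀ i, ∑ a, (if f i = a then Real.exp l else 1) = m - 1 + Real.exp l := by
      intro i
      have : ∀ a, (if f i = a then Real.exp l else 1) =
          1 + if f i = a then Real.exp l - 1 else 0 := fun a => by split_ifs <;> ring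
      simp_rw [this]
      rw [Finset.sum_add_distrib, Finset.sum_ite_eq]
      simp
      ring
    simp [h3]
  simp_rw [h1, h2]
  rw [Finset.sum_const, nsmul_eq_mul]
  have h4 : (m - 1 + Real.exp l) ≤ m * Real.exp ((Real.exp l - 1) / m) := by
    have := Real.add_one_le_exp ((Real.exp l - 1) / m)
    calc (m - 1 + Real.exp l) = m * ((Real.exp l - 1) / m + 1) := by field_simp; ring
      _ ≤ _ := by gcongr
  have h5 : 0 ≤ (m - 1 + Real.exp l) := by
    have := Real.add_one_le_exp l
    linarith
  have h6 : (m - 1 + Real.exp l) ^ κ ≤ m ^ κ * Real.exp (κ * (Real.exp l - 1) / m) := by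
    refine (pow_le_pow_left₀ h5 h4 κ).trans_eq ?_
    rw [mul_pow, ← Real.exp_nat_mul, mul_div_assoc]
  simp only [Finset.card_univ, Fintype.card_fun, Fintype.card_fin, Nat.cast_pow]
  calc (m : ℝ) ^ κ * (m - 1 + Real.exp l) ^ κ
      ≤ m ^ κ * (m ^ κ * Real.exp (κ * (Real.exp l - 1) / m)) := by gcongr
    _ = _ := by ring

/-! ### A block mixture against the null law. -/

/-- The law of the data when the response `N(0, t)` is independent of the design. -/
noncomputable def nullLaw (n p : ℕ) (t : ℝ) : Measure (Data n p) :=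
  Measure.pi fun _ : Fin n => nullRowLaw p t

instance (n p : ℕ) (t : ℝ) : IsProbabilityMeasure (nullLaw n p t) := by
  unfold nullLaw; infer_instance

lemma law_eq_withDensity {n p : ℕ} {θ : Param p} (hΩ : θ.Omega = 1) (hσ : 0 < θ.sigma)
    {t : ℝ} (ht : 0 < t) :
    law n θ = (nullLaw n p t).withDensity (fun z => ENNReal.ofReal
      (∏ i, likRatio (θ.sigma ^ 2) t (WithLp.toLp 2 θ.beta) (z i))) := by
  have h := rowLaw_eq_withDensity hΩ hσ ht
  have : IsProbabilityMeasure ((nullRowLaw p t).withDensity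
      (fun w => ENNReal.ofReal (likRatio (θ.sigma ^ 2) t (WithLp.toLp 2 θ.beta) w))) := by
    rw [← h]; infer_instance
  rw [law, h, pi_withDensity _ (by fun_prop), nullLaw]
  congr 1
  ext z
  rw [ENNReal.ofReal_prod_of_nonneg fun i _ => likRatio_nonneg _ _ _ _]

/-- The second moment depends on a pair of draws only through its agreement count `J`. Here `η`
bounds the logarithmic cost of the energy alone and `l` the cost per agreement. -/
lemma abs_blockMixture_sub_nullLaw_le {n p κ m : ℕ} (hm : 0 < m) {φ : Fin κ × Fin m → Fin p}
    (hφ : Function.Injective φ) {w : Fin p → ℝ} {x : ℝ} (hw : ∀ z, w (φ z) ^ 2 = x)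
    {σ t : ℝ} (hσ : 0 < σ) (ht : 0 < t) {η l ε : ℝ} (hl : 0 ≤ l) (hε : 0 < ε)
    (hlt : ∀ J : ℕ, J ≤ κ → σ ^ 2 + κ * x + J * x < 2 * t)
    (hR : ∀ J : ℕ, J ≤ κ → (t / √((2 * t - σ ^ 2 - κ * x - J * x) *
      (σ ^ 2 + κ * x - J * x))) ^ n ≤ Real.exp (η + l * J))
    (hle : Real.exp (η + κ * (Real.exp l - 1) / m) ≤ 1 + ε ^ 2)
    {E : Set (Data n p)} (hE : MeasurableSet E) :
    |(∑ f : Fin κ → Fin m, (law n ⟨blockVec φ w f, 1, σ⟩).real E) /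
      Fintype.card (Fin κ → Fin m) - (nullLaw n p t).real E| ≤ ε := by
  have : Nonempty (Fin m) := ⟨⟨0, hm⟩⟩
  set b : (Fin κ → Fin m) → EuclideanSpace ℝ (Fin p) := fun f => WithLp.toLp 2 (blockVec φ w f)
    with hb
  have hinner : ∀ f g, inner ℝ (b f) (b g) =
      ((Finset.univ.filter fun i => f i = g i).card : ℝ) * x := by
    intro f g
    rw [← sum_blockVec_mul_blockVec hφ hw, PiLp.inner_apply]
    refine Finset.sum_congr rfl fun j _ => ?_
    simp [hb, mul_comm]
  have hnorm : ∀ f, ‖b f‖ ^ 2 = κ * x := by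
    intro f
    rw [← real_inner_self_eq_norm_sq, hinner]
    simp
  have hcard : ∀ f g : Fin κ → Fin m, (Finset.univ.filter fun i => f i = g i).card ≤ κ :=
    fun f g => (Finset.card_filter_le _ _).trans (by simp)
  have hmeas : ∀ f, Measurable fun z : Data n p => ∏ i, likRatio (σ ^ 2) t (b f) (z i) := fun f =>
    Finset.measurable_prod _ fun i _ => (measurable_likRatio _ _ _).comp (measurable_pi_apply i)
  have hdens : ∀ f, law n ⟨blockVec φ w f, 1, σ⟩ = (nullLaw n p t).withDensity
      fun z => ENNReal.ofReal (∏ i, likRatio (σ ^ 2) t (b f) (z i)) := fun f =>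
    law_eq_withDensity (θ := ⟨blockVec φ w f, 1, σ⟩) rfl hσ ht
  refine abs_mixture_sub_le (A := Fin κ → Fin m) (nullLaw n p t)
    (P := fun f => law n ⟨blockVec φ w f, 1, σ⟩)
    (g := fun f z => ∏ i, likRatio (σ ^ 2) t (b f) (z i)) hmeas
    (fun f z => Finset.prod_nonneg fun i _ => likRatio_nonneg _ _ _ _) hdens
    (r := fun f g => Real.exp (η + l * (Finset.univ.filter fun i => f i = g i).card))
    ?_ (fun _ _ => (Real.exp_pos _).le) hε ?_ hE
  · intro f g
    have h1 : ∀ z : Data n p, ENNReal.ofReal (∏ i, likRatio (σ ^ 2) t (b f) (z i)) *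
        ENNReal.ofReal (∏ i, likRatio (σ ^ 2) t (b g) (z i)) =
        ∏ i, (ENNReal.ofReal (likRatio (σ ^ 2) t (b f) (z i)) *
          ENNReal.ofReal (likRatio (σ ^ 2) t (b g) (z i))) := fun z => by
      rw [ENNReal.ofReal_prod_of_nonneg fun i _ => likRatio_nonneg _ _ _ _,
        ENNReal.ofReal_prod_of_nonneg fun i _ => likRatio_nonneg _ _ _ _, Finset.prod_mul_distrib]
    simp_rw [h1]
    have h2 := lintegral_likRatio_mul_likRatio (t := t) (by positivity : 0 < σ ^ 2) ht (hnorm f)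
      (hnorm g) (by rw [hinner]; exact hlt _ (hcard f g))
    rw [nullLaw, lintegral_pi_prod (nullRowLaw p t) (f := fun _ w =>
      ENNReal.ofReal (likRatio (σ ^ 2) t (b f) w) * ENNReal.ofReal (likRatio (σ ^ 2) t (b g) w))
      (fun _ => by fun_prop), h2, Finset.prod_const, Finset.card_univ, Fintype.card_fin,
      ← ENNReal.ofReal_pow (by positivity), hinner]
    exact ENNReal.ofReal_le_ofReal (hR _ (hcard f g))
  · simp_rw [Real.exp_add, ← Finset.mul_sum]
    calc _ ≤ Real.exp η * (Real.exp (κ * (Real.exp l - 1) / m) * ((m : ℝ) ^ κ) ^ 2) := by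
          gcongr
          exact sum_exp_agreements_le hm l hl
      _ = Real.exp (η + κ * (Real.exp l - 1) / m) * ((m : ℝ) ^ κ) ^ 2 := by
          rw [Real.exp_add]; ring
      _ ≤ _ := by
          simp only [Fintype.card_fun, Fintype.card_fin, Nat.cast_pow]
          gcongr

/-! ### Blocks inside the support of a dense loading. -/

lemma exists_injective_blocks {p κ m : ℕ} {ξ : Fin p → ℝ} (h : κ * m ≤ hammingNorm ξ) :
    ∃ φ : Fin κ × Fin m → Fin p, Function.Injective φ ∧ ∀ z, ξ (φ z) ≠ 0 := by
  have : Fintype.card (Fin κ × Fin m) ≤ Fintype.card {j // ξ j ≠ 0} := by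
    rw [Fintype.card_subtype]
    simpa [hammingNorm] using h
  obtain ⟨e⟩ := Function.Embedding.nonempty_of_card_le this
  exact ⟨fun z => (e z).1, Subtype.val_injective.comp e.injective, fun z => (e z).2⟩

lemma norm_div_le_abs_of_mem_loadings {p q : ℕ} {cbar : ℝ} (hc : 0 < cbar) {ξ : Fin p → ℝ}
    (hξ : ξ ∈ loadings p q cbar) {j : Fin p} (hj : ξ j ≠ 0) : ‖ξ‖ / cbar ≤ |ξ j| := by
  rw [div_le_iff₀ hc, pi_norm_le_iff_of_nonneg (by positivity)]
  intro i
  by_cases hi : ξ i = 0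
  · rw [hi, norm_zero]; positivity
  · have := hξ.2.2 i j hi hj
    rwa [div_le_iff₀ (abs_pos.2 hj), mul_comm] at this

lemma real_sign_sq {x : ℝ} (hx : x ≠ 0) : Real.sign x ^ 2 = 1 := by
  rcases Real.sign_apply_eq_of_ne_zero x hx with h | h <;> simp [h]

lemma linFunctional_blockVec_sign {p κ m : ℕ} (φ : Fin κ × Fin m → Fin p) (ξ : Fin p → ℝ) (a : ℝ)
    (f : Fin κ → Fin m) (Ω : Matrix (Fin p) (Fin p) ℝ) (σ : ℝ) :
    linFunctional ξ ⟨blockVec φ (fun j => a * Real.sign (ξ j)) f, Ω, σ⟩ =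
      a * ∑ i, |ξ (φ (i, f i))| := by
  rw [linFunctional, sum_mul_blockVec, Finset.mul_sum]
  refine Finset.sum_congr rfl fun i _ => ?_
  rcases lt_trichotomy (ξ (φ (i, f i))) 0 with h | h | h
  · rw [Real.sign_of_neg h, abs_of_neg h]; ring
  · simp [h]
  · rw [Real.sign_of_pos h, abs_of_pos h]; ring

lemma le_sum_abs_blocks {p q κ m : ℕ} {cbar : ℝ} (hc : 0 < cbar) {ξ : Fin p → ℝ}
    (hξ : ξ ∈ loadings p q cbar) {φ : Fin κ × Fin m → Fin p} (hφ : ∀ z, ξ (φ z) ≠ 0)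
    (f : Fin κ → Fin m) : κ * (‖ξ‖ / cbar) ≤ ∑ i, |ξ (φ (i, f i))| := by
  have := Finset.card_nsmul_le_sum Finset.univ (fun i => |ξ (φ (i, f i))|) (‖ξ‖ / cbar)
    fun i _ => norm_div_le_abs_of_mem_loadings hc hξ (hφ _)
  simpa using this

/-- `(1 + y)² (1 - y) = 1 + y (1 - y - y²)`, and `y + y² ≤ 1` on this range. -/
lemma one_le_exp_two_mul_mul_one_sub {y : ℝ} (h0 : 0 ≤ y) (h1 : y ≤ 3 / 5) :
    1 ≤ Real.exp (2 * y) * (1 - y) := by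
  have h := Real.add_one_le_exp y
  have h2 : (1 + y) ^ 2 ≤ Real.exp (2 * y) := by
    rw [two_mul, Real.exp_add, ← sq]
    gcongr
    linarith
  have h3 : 0 ≤ 1 - y := by linarith
  calc 1 ≤ (1 + y) ^ 2 * (1 - y) := by nlinarith [mul_nonneg h0 h0]
    _ ≤ _ := by gcongr

lemma blockVec_mem_knownSpace {p k κ m : ℕ} (φ : Fin κ × Fin m → Fin p) (w : Fin p → ℝ)
    (f : Fin κ → Fin m) (σ : ℝ) (h : κ ≤ k) :
    (⟨blockVec φ w f, 1, σ⟩ : Param p) ∈ knownSpace p k σ :=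
  ⟨(hammingNorm_blockVec_le φ w f).trans h, rfl, rfl⟩

/-! ### The two testing bounds. -/

/-- The lower bound from testing `β = 0` against a block mixture. -/
lemma le_benchmark_of_zero_null {n p q k k₁ κ m : ℕ} {α σ cbar ε r : ℝ} {ξ : Fin p → ℝ}
    (hc : 0 < cbar) (hσ : 0 < σ) (hξ : ξ ∈ loadings p q cbar) (hk₁ : k₁ ≤ k) (hκ : κ ≤ k)
    (hm : 0 < m) (hκm : κ * m ≤ q) (hε : 0 < ε) (hr : 0 ≤ r) (hκr : κ * r ^ 2 ≤ 1 / 4)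
    (hle : Real.exp (n * (κ * r ^ 2) ^ 2 + κ * (Real.exp (2 * n * r ^ 2) - 1) / m) ≤ 1 + ε ^ 2) :
    ENNReal.ofReal (κ * r * σ * ‖ξ‖ / cbar * (1 - 2 * α - 3 * ε)) ≤
      benchmark n α (knownSpace p k₁ σ) (knownSpace p k σ) (linFunctional ξ) := by
  obtain ⟨φ, hφ, hφξ⟩ := exists_injective_blocks (ξ := ξ) (hκm.trans_eq hξ.1.symm)
  have hsub : knownSpace p k₁ σ ⊆ knownSpace p k σ := fun θ h => ⟨h.1.trans hk₁, h.2⟩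
  have hσ2 : 0 < σ ^ 2 := by positivity
  have : Nonempty (Fin m) := ⟨⟨0, hm⟩⟩
  have hT : ∀ f, κ * r * σ * ‖ξ‖ / cbar ≤ linFunctional ξ
      ⟨blockVec φ (fun j => σ * r * Real.sign (ξ j)) f, 1, σ⟩ := by
    intro f
    rw [linFunctional_blockVec_sign]
    calc κ * r * σ * ‖ξ‖ / cbar = σ * r * (κ * (‖ξ‖ / cbar)) := by ring
      _ ≤ _ := by
        gcongr
        exact le_sum_abs_blocks hc hξ hφξ f
  have hnull : ∀ E, MeasurableSet E → |(∑ _a : Unit, (law n (⟨0, 1, σ⟩ : Param p)).real E) /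
      Fintype.card Unit - (nullLaw n p (σ ^ 2)).real E| ≤ ε := by
    intro E _
    have h0 : law n (⟨0, 1, σ⟩ : Param p) = nullLaw n p (σ ^ 2) := by
      have hone : ∀ w : ℝ × EuclideanSpace ℝ (Fin p),
          likRatio (σ ^ 2) (σ ^ 2) (WithLp.toLp 2 (0 : Fin p → ℝ)) w = 1 := by
        intro w
        rw [likRatio, WithLp.toLp_zero, inner_zero_left, div_self]
        exact (gaussianPDFReal_pos _ _ _ (by simpa using hσ.ne')).ne'
      rw [law_eq_withDensity (θ := ⟨0, 1, σ⟩) rfl hσ hσ2]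
      simp only [hone]
      simp
    simp [h0, hε.le]
  have halt : ∀ E, MeasurableSet E → |(∑ f : Fin κ → Fin m,
      (law n ⟨blockVec φ (fun j => σ * r * Real.sign (ξ j)) f, 1, σ⟩).real E) /
        Fintype.card (Fin κ → Fin m) - (nullLaw n p (σ ^ 2)).real E| ≤ ε := by
    intro E hE
    refine abs_blockMixture_sub_nullLaw_le hm hφ (x := σ ^ 2 * r ^ 2) ?_ hσ hσ2
      (η := n * (κ * r ^ 2) ^ 2) (l := 2 * n * r ^ 2) (by positivity) hε ?_ ?_ hle hE
    · intro z
      rw [mul_pow, real_sign_sq (hφξ z)]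
      ring
    · intro J hJ
      have hJ' : (J : ℝ) * r ^ 2 ≤ κ * r ^ 2 := by gcongr
      nlinarith
    · intro J hJ
      have hJ' : (J : ℝ) * r ^ 2 ≤ κ * r ^ 2 := by gcongr
      have hJ0 : 0 ≤ (J : ℝ) * r ^ 2 := by positivity
      set a := (J : ℝ) * r ^ 2 with ha
      set b := (κ : ℝ) * r ^ 2 with hb
      have e1 : (2 * σ ^ 2 - σ ^ 2 - κ * (σ ^ 2 * r ^ 2) - J * (σ ^ 2 * r ^ 2)) *
          (σ ^ 2 + κ * (σ ^ 2 * r ^ 2) - J * (σ ^ 2 * r ^ 2)) =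
          (σ ^ 2) ^ 2 * ((1 - a) ^ 2 - b ^ 2) := by rw [ha, hb]; ring
      -- With `a ≤ b ≤ 1/4`, `2a + b² ≤ 9/16 < 3/5`. The `b²` is the price of the visible variance
      -- and produces `η`.
      have hy := one_le_exp_two_mul_mul_one_sub (y := 2 * a + b ^ 2) (by positivity) (by nlinarith)
      have e2 : 1 / √((1 - a) ^ 2 - b ^ 2) ≤ Real.exp (2 * a + b ^ 2) := by
        have hpos : 0 < (1 - a) ^ 2 - b ^ 2 := by nlinarith
        rw [div_le_iff₀ (by positivity), ← Real.sqrt_sq (Real.exp_pos (2 * a + b ^ 2)).le,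
          ← Real.sqrt_mul (by positivity), Real.one_le_sqrt, ← Real.exp_nat_mul]
        push_cast
        exact hy.trans (mul_le_mul_of_nonneg_left (by linarith [sq_nonneg a]) (Real.exp_pos _).le)
      rw [e1, Real.sqrt_mul (by positivity), Real.sqrt_sq hσ2.le, ← div_div, div_self hσ2.ne']
      calc (1 / √((1 - a) ^ 2 - b ^ 2)) ^ n ≤ Real.exp (2 * a + b ^ 2) ^ n := by gcongr
        _ = _ := by
          rw [← Real.exp_nat_mul, ha]
          congr 1
          ring
  refine le_iInf₂ fun C hC => ?_
  exact le_maxExpectedLength (A₀ := Unit) (A₁ := Fin κ → Fin m) hC hsub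
    (θ₀ := fun _ => ⟨0, 1, σ⟩)
    (θ₁ := fun f => ⟨blockVec φ (fun j => σ * r * Real.sign (ξ j)) f, 1, σ⟩)
    (fun _ => ⟨by simp, rfl, rfl⟩) (fun f => blockVec_mem_knownSpace _ _ _ _ hκ)
    (by positivity) (fun _ => by simp [linFunctional]) hT (nullLaw n p (σ ^ 2)) hnull halt

/-- The lower bound from testing two block mixtures of equal energy and opposite signs. -/
lemma le_benchmark_of_mixture_null {n p q k k₁ m : ℕ} {α σ cbar ε r : ℝ} {ξ : Fin p → ℝ}
    (hc : 0 < cbar) (hσ : 0 < σ) (hξ : ξ ∈ loadings p q cbar) (hk₁ : k₁ ≤ k) (hk : 0 < k)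
    (hm : 0 < m) (hkm : k * m ≤ q) (hε : 0 < ε) (hr : 0 ≤ r) (hkr : k₁ * r ^ 2 ≤ 1)
    (hle : Real.exp (k * (Real.exp (2 * n * r ^ 2) - 1) / m) ≤ 1 + ε ^ 2) :
    ENNReal.ofReal (√(k * k₁) * r * σ * ‖ξ‖ / cbar * (1 - 2 * α - 3 * ε)) ≤
      benchmark n α (knownSpace p k₁ σ) (knownSpace p k σ) (linFunctional ξ) := by
  have hsub : knownSpace p k₁ σ ⊆ knownSpace p k σ := fun θ h => ⟨h.1.trans hk₁, h.2⟩
  obtain ⟨φ, hφ, hφξ⟩ := exists_injective_blocks (ξ := ξ) (hkm.trans_eq hξ.1.symm)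
  obtain ⟨φ', hφ', hφξ'⟩ := exists_injective_blocks (κ := k₁) (m := m) (ξ := ξ)
    ((Nat.mul_le_mul_right m hk₁).trans (hkm.trans_eq hξ.1.symm))
  have hσ2 : 0 < σ ^ 2 := by positivity
  have hk' : (0 : ℝ) < k := by exact_mod_cast hk
  have hk₁' : (k₁ : ℝ) ≤ k := by exact_mod_cast hk₁
  have : Nonempty (Fin m) := ⟨⟨0, hm⟩⟩
  -- The variance of `y` under both mixtures. It turns the product under the root into the square
  -- `(t - J x)²`, hence `η = 0`.
  set t : ℝ := σ ^ 2 + k₁ * (σ ^ 2 * r ^ 2) with ht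
  have ht0 : 0 < t := by positivity
  have close : ∀ {κ : ℕ} {ψ : Fin κ × Fin m → Fin p} {a x : ℝ}, Function.Injective ψ →
      (∀ z, ξ (ψ z) ≠ 0) → a ^ 2 = x → κ ≤ k → κ * x = k₁ * (σ ^ 2 * r ^ 2) → x ≤ σ ^ 2 * r ^ 2 →
      ∀ E, MeasurableSet E → |(∑ f : Fin κ → Fin m,
        (law n ⟨blockVec ψ (fun j => a * Real.sign (ξ j)) f, 1, σ⟩).real E) /
          Fintype.card (Fin κ → Fin m) - (nullLaw n p t).real E| ≤ ε := by
    intro κ ψ a x hψ hψξ hax hκ hκx hx E hE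
    have hx0 : 0 ≤ x := hax ▸ sq_nonneg a
    have hJx : ∀ J : ℕ, J ≤ κ → J * x ≤ k₁ * (σ ^ 2 * r ^ 2) := fun J hJ => by
      rw [← hκx]; gcongr
    refine abs_blockMixture_sub_nullLaw_le hm hψ (x := x) ?_ hσ ht0
      (η := 0) (l := 2 * n * r ^ 2) (by positivity) hε ?_ ?_ ?_ hE
    · intro z
      rw [mul_pow, real_sign_sq (hψξ z), hax, mul_one]
    · intro J hJ
      have := hJx J hJ
      rw [hκx, ht]
      linarith
    · intro J hJ
      have h1 := hJx J hJ
      have h2 : 0 < t - J * x := by rw [ht]; linarith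
      have e1 : (2 * t - σ ^ 2 - κ * x - J * x) * (σ ^ 2 + κ * x - J * x) = (t - J * x) ^ 2 := by
        rw [hκx, ht]; ring
      have hy0 : 0 ≤ J * x / t := by positivity
      have hy1 : J * x / t ≤ 3 / 5 := by
        rw [div_le_iff₀ ht0, ht]
        nlinarith
      have hy := one_le_exp_two_mul_mul_one_sub hy0 hy1
      have e2 : t / (t - J * x) ≤ Real.exp (2 * (J * x / t)) := by
        rw [div_le_iff₀ h2]
        have : 1 - J * x / t = (t - J * x) / t := by field_simp
        rw [this, ← mul_div_assoc, le_div_iff₀ ht0, one_mul] at hy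
        exact hy
      have e3 : J * x / t ≤ J * r ^ 2 := by
        rw [div_le_iff₀ ht0]
        calc J * x ≤ J * (σ ^ 2 * r ^ 2) := by gcongr
          _ = J * r ^ 2 * σ ^ 2 := by ring
          _ ≤ J * r ^ 2 * t := by
            gcongr
            rw [ht]
            have : 0 ≤ k₁ * (σ ^ 2 * r ^ 2) := by positivity
            linarith
      rw [e1, Real.sqrt_sq h2.le]
      calc (t / (t - J * x)) ^ n ≤ Real.exp (2 * (J * r ^ 2)) ^ n := by
            gcongr
            exact e2.trans (by gcongr)
        _ = _ := by
          rw [← Real.exp_nat_mul]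
          congr 1
          ring
    · refine le_trans ?_ hle
      rw [zero_add]
      have : 0 ≤ Real.exp (2 * n * r ^ 2) - 1 := by
        have := Real.one_le_exp (show 0 ≤ 2 * n * r ^ 2 by positivity)
        linarith
      gcongr
  -- The amplitude giving `k` coordinates the energy of `k₁` coordinates of size `σ r`.
  have hx : (σ * r * √(k₁ / k)) ^ 2 = k₁ / k * (σ ^ 2 * r ^ 2) := by
    rw [mul_pow, Real.sq_sqrt (by positivity)]
    ring
  set w₀ : Fin p → ℝ := fun j => -(σ * r) * Real.sign (ξ j) with hw₀
  set w₁ : Fin p → ℝ := fun j => σ * r * √(k₁ / k) * Real.sign (ξ j) with hw₁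
  have hT₀ : ∀ f, linFunctional ξ ⟨blockVec φ' w₀ f, 1, σ⟩ ≤ 0 := by
    intro f
    rw [linFunctional_blockVec_sign, neg_mul, neg_nonpos]
    positivity
  have hT₁ : ∀ f, √(k * k₁) * r * σ * ‖ξ‖ / cbar ≤ linFunctional ξ ⟨blockVec φ w₁ f, 1, σ⟩ := by
    intro f
    rw [linFunctional_blockVec_sign]
    have : √((k : ℝ) * k₁) = √(k₁ / k) * k := by
      rw [show (k : ℝ) * k₁ = k₁ / k * k ^ 2 by field_simp, Real.sqrt_mul (by positivity),
        Real.sqrt_sq hk'.le]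
    calc √(k * k₁) * r * σ * ‖ξ‖ / cbar = σ * r * √(k₁ / k) * (k * (‖ξ‖ / cbar)) := by
          rw [this]; ring
      _ ≤ _ := by
        gcongr
        exact le_sum_abs_blocks hc hξ hφξ f
  have hnull := close (κ := k₁) (ψ := φ') (a := -(σ * r)) (x := σ ^ 2 * r ^ 2) hφ' hφξ' (by ring)
    hk₁ rfl le_rfl
  have halt := close (κ := k) (ψ := φ) hφ hφξ hx le_rfl (by field_simp)
    (mul_le_of_le_one_left (by positivity) ((div_le_one hk').2 hk₁'))
  refine le_iInf₂ fun C hC => ?_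
  exact le_maxExpectedLength (A₀ := Fin k₁ → Fin m) (A₁ := Fin k → Fin m) hC hsub
    (θ₀ := fun f => ⟨blockVec φ' w₀ f, 1, σ⟩) (θ₁ := fun f => ⟨blockVec φ w₁ f, 1, σ⟩)
    (fun f => blockVec_mem_knownSpace _ _ _ _ le_rfl)
    (fun f => blockVec_mem_knownSpace _ _ _ _ le_rfl)
    (by positivity) hT₀ hT₁ (nullLaw n p t) hnull halt

/-! ### Choice of constants. -/

open Filter Topology in
-- Each constraint is continuous in `δ` and strict at `δ = 0`.
lemma exists_small_signal {ε c ω : ℝ} (hε : 0 < ε) (hω : 0 < ω) :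
    ∃ δ : ℝ, 0 < δ ∧ δ ^ 2 ≤ 1 / 4 ∧ δ ^ 2 * c ≤ 1 ∧ 2 * δ ^ 2 ≤ ω / 2 ∧
      Real.exp (δ ^ 4 + (Real.exp (2 * δ ^ 2) - 1)) ≤ 1 + ε ^ 2 := by
  have key : ∀ (f : ℝ → ℝ) (y : ℝ), Continuous f → f 0 < y → ∀ᶠ δ in 𝓝[>] (0 : ℝ), f δ ≤ y :=
    fun f y hf h => ((hf.tendsto 0).eventually (eventually_le_nhds h)).filter_mono
      nhdsWithin_le_nhds
  have h1 := key (fun δ => δ ^ 2) (1 / 4) (by fun_prop) (by norm_num)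
  have h2 := key (fun δ => δ ^ 2 * c) 1 (by fun_prop) (by norm_num)
  have h3 := key (fun δ => 2 * δ ^ 2) (ω / 2) (by fun_prop) (by simpa using hω)
  have h4 := key (fun δ => Real.exp (δ ^ 4 + (Real.exp (2 * δ ^ 2) - 1))) (1 + ε ^ 2)
    (by fun_prop) (by simpa using pow_pos hε 2)
  obtain ⟨δ, h1, h2, h3, h4, h5⟩ :=
    (h1.and (h2.and (h3.and (h4.and self_mem_nhdsWithin)))).exists
  exact ⟨δ, h5, h1, h2, h3, h4⟩

open Filter in
-- With `ω = γq - 2γ > 0`, the right side exceeds the left by a factor of order `p ^ (ω / 2)`.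
lemma exists_large_dimension {c cq γ γq s : ℝ} (hcq : 0 < cq) (hγ : 2 * γ < γq) (hs : 0 < s) :
    ∃ N : ℕ, 1 ≤ N ∧ ∀ p : ℕ, N ≤ p →
      2 * (c * (p : ℝ) ^ γ) ^ 2 * (p : ℝ) ^ ((γq - 2 * γ) / 2) ≤ s * (cq * (p : ℝ) ^ γq) := by
  have h := (tendsto_rpow_atTop (show 0 < (γq - 2 * γ) / 2 by linarith)).comp
    (tendsto_natCast_atTop_atTop (R := ℝ))
  obtain ⟨N, hN⟩ := eventually_atTop.1 (h.eventually_ge_atTop (2 * c ^ 2 / (s * cq)))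
  refine ⟨max N 1, le_max_right _ _, fun p hp => ?_⟩
  have hp0 : (0 : ℝ) < p := by exact_mod_cast (le_max_right N 1).trans hp
  have h1 := hN p ((le_max_left _ _).trans hp)
  simp only [Function.comp_apply] at h1
  rw [div_le_iff₀ (by positivity)] at h1
  have e : (p : ℝ) ^ γq = ((p : ℝ) ^ γ) ^ 2 * ((p : ℝ) ^ ((γq - 2 * γ) / 2) *
      (p : ℝ) ^ ((γq - 2 * γ) / 2)) := by
    rw [← Real.rpow_natCast, ← Real.rpow_mul hp0.le, ← Real.rpow_add hp0, ← Real.rpow_add hp0]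
    congr 1
    push_cast
    ring
  rw [e]
  calc 2 * (c * (p : ℝ) ^ γ) ^ 2 * (p : ℝ) ^ ((γq - 2 * γ) / 2)
      = 2 * c ^ 2 * (((p : ℝ) ^ γ) ^ 2 * (p : ℝ) ^ ((γq - 2 * γ) / 2)) := by ring
    _ ≤ (p : ℝ) ^ ((γq - 2 * γ) / 2) * (s * cq) *
        (((p : ℝ) ^ γ) ^ 2 * (p : ℝ) ^ ((γq - 2 * γ) / 2)) := by gcongr
    _ = _ := by ring

/-- The exponent of the second-moment bound when the support is large compared to `k ^ 2`. -/
lemma block_exponent_le {k q : ℕ} {s e : ℝ} (hk : 0 < k) (hs1 : s ≤ 1) (he : 1 ≤ e)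
    (h : 2 * (k : ℝ) ^ 2 * e ≤ s * q) : 0 < q / k ∧ k * (e - 1) / (q / k : ℕ) ≤ s := by
  have hk' : (1 : ℝ) ≤ k := by exact_mod_cast hk
  have hkq : (k : ℝ) ≤ q := by
    have : s * q ≤ q := mul_le_of_le_one_left (by positivity) hs1
    nlinarith [mul_nonneg (sub_nonneg.2 hk') (sub_nonneg.2 he)]
  have hm : 0 < q / k := Nat.div_pos (by exact_mod_cast hkq) hk
  have hm' : (1 : ℝ) ≤ (q / k : ℕ) := by exact_mod_cast hm
  -- Rounding `q / k` down loses at most a factor 2, whence the 2 in the hypothesis.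
  have hlt : (q : ℝ) ≤ 2 * k * (q / k : ℕ) := by
    have h1 : q < k * (q / k + 1) := Nat.lt_mul_div_succ q hk
    have h2 : (q : ℝ) < k * ((q / k : ℕ) + 1) := by exact_mod_cast h1
    nlinarith
  refine ⟨hm, ?_⟩
  have hs0 : 0 ≤ s := by
    by_contra hneg
    have : s * q ≤ 0 := mul_nonpos_of_nonpos_of_nonneg (not_le.1 hneg).le (by positivity)
    have : 0 < 2 * (k : ℝ) ^ 2 * e := by positivity
    linarith
  rw [div_le_iff₀ (by linarith)]
  have h3 : s * q ≤ s * (2 * k * (q / k : ℕ)) := by gcongr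
  have h4 : (k : ℝ) * e ≤ s * (q / k : ℕ) := by
    refine le_of_mul_le_mul_left (a := 2 * (k : ℝ)) ?_ (by positivity)
    nlinarith
  nlinarith

end HDLinReg

/-! ### Assembly. -/

theorem theorem8 (α : ℝ) (hα : 0 < α) (hα' : α < 1 / 2)
    (c : ℝ) (hc : 0 < c) (γ : ℝ) (hγ : 0 ≤ γ) (hγ' : γ < 1 / 2)
    (cbar : ℝ) (hcbar : 1 ≤ cbar)
    (cq : ℝ) (hcq : 0 < cq) (γq : ℝ) (hγq : 2 * γ < γq) (hγq' : γq ≤ 1) :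
    ∃ c₁ : ℝ, 0 < c₁ ∧
      ∀ (n p k k₁ q : ℕ) (σ₀ : ℝ) (ξ : Fin p → ℝ),
        1 ≤ n → 0 < σ₀ → k₁ ≤ k →
        (k : ℝ) ≤ c * (p : ℝ) ^ γ → (k : ℝ) * Real.log p ≤ c * n →
        ξ ∈ HDLinReg.loadings p q cbar → cq * (p : ℝ) ^ γq ≤ (q : ℝ) →
        ENNReal.ofReal
            (c₁ * ‖ξ‖ * σ₀ *
              max (Real.sqrt ((k : ℝ) * k₁) * Real.sqrt (Real.log p / n))
                (min ((k : ℝ) * Real.sqrt (Real.log p / n))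
                  (Real.sqrt k / (n : ℝ) ^ (1 / 4 : ℝ)))) ≤
          HDLinReg.benchmark n α (HDLinReg.knownSpace p k₁ σ₀) (HDLinReg.knownSpace p k σ₀)
            (HDLinReg.linFunctional ξ) := by
  set ε : ℝ := (1 - 2 * α) / 6 with hεdef
  have hε : 0 < ε := by rw [hεdef]; linarith
  have hgap : 1 - 2 * α - 3 * ε = 3 * ε := by rw [hεdef]; ring
  have hcb : 0 < cbar := by linarith
  obtain ⟨δ, hδ, hδ4, hδc, hδω, hδε⟩ :=
    HDLinReg.exists_small_signal (c := c) (ω := γq - 2 * γ) hε (by linarith)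
  obtain ⟨N, -, hN⟩ :=
    HDLinReg.exists_large_dimension (c := c) (s := δ ^ 4) hcq hγq (by positivity)
  have hδ41 : δ ^ 4 ≤ 1 := by
    have : δ ^ 4 = (δ ^ 2) ^ 2 := by ring
    rw [this]
    nlinarith [sq_nonneg δ]
  have hδexp : δ ^ 4 ≤ Real.exp (2 * δ ^ 2) - 1 := by
    have := Real.add_one_le_exp (2 * δ ^ 2)
    have h4 : δ ^ 4 = δ ^ 2 * δ ^ 2 := by ring
    nlinarith [sq_nonneg δ]
  -- For `p < N` the target rate is at most `B / √n`, since `k ≤ c N` and `log p ≤ N`.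
  set B : ℝ := 1 + c * N * √N with hB
  have hB1 : 1 ≤ B := by
    have : 0 ≤ c * N * √N := by positivity
    linarith
  have hB0 : 0 < B := by linarith
  refine ⟨δ * (3 * ε) / (cbar * B), by positivity, ?_⟩
  intro n p k k₁ q σ₀ ξ hn hσ hk₁ hkp hkn hξ hq
  have hn' : (1 : ℝ) ≤ n := by exact_mod_cast hn
  have hn0 : (0 : ℝ) < n := by linarith
  have hqpos : 0 < q := by
    rw [← hξ.1]
    exact hammingNorm_pos_iff.2 hξ.2.1
  have hp : 1 ≤ p := by
    have h := hammingNorm_le_card_fintype (x := ξ)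
    rw [Fintype.card_fin] at h
    exact (hammingNorm_pos_iff.2 hξ.2.1).trans_le h
  have hp' : (1 : ℝ) ≤ p := by exact_mod_cast hp
  have hp0 : (0 : ℝ) < p := by linarith
  have hlog : 0 ≤ Real.log p := Real.log_nonneg hp'
  rcases Nat.eq_zero_or_pos k with rfl | hk
  · simp
  have hk' : (1 : ℝ) ≤ k := by exact_mod_cast hk
  have hk0 : (0 : ℝ) < k := by linarith
  have hk₁' : (k₁ : ℝ) ≤ k := by exact_mod_cast hk₁
  set L : ℝ := √(Real.log p / n) with hL
  have hL0 : 0 ≤ L := Real.sqrt_nonneg _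
  have hLsq : L ^ 2 = Real.log p / n := Real.sq_sqrt (by positivity)
  have hsqrt : √((k : ℝ) * k₁) ≤ k := by
    rw [Real.sqrt_le_left hk0.le, sq]
    gcongr
  rcases lt_or_ge p N with hpN | hpN
  · have hpN' : (p : ℝ) ≤ N := by exact_mod_cast hpN.le
    have hmax : max (√((k : ℝ) * k₁) * L) (min (k * L) (√k / (n : ℝ) ^ (1 / 4 : ℝ))) ≤
        B * (1 / √n) := by
      have h1 : k * L ≤ B * (1 / √n) := by
        have hkN : (k : ℝ) ≤ c * N := by
          refine hkp.trans ?_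
          gcongr
          calc (p : ℝ) ^ γ ≤ (p : ℝ) ^ (1 : ℝ) :=
                Real.rpow_le_rpow_of_exponent_le hp' (by linarith)
            _ ≤ N := by rwa [Real.rpow_one]
        have hLN : L ≤ √N / √n := by
          rw [hL, Real.sqrt_div hlog]
          gcongr
          exact (Real.log_le_self hp0.le).trans hpN'
        calc k * L ≤ c * N * (√N / √n) := by gcongr
          _ = c * N * √N * (1 / √n) := by ring
          _ ≤ B * (1 / √n) := by
            gcongr
            rw [hB]
            linarith
      exact max_le ((mul_le_mul_of_nonneg_right hsqrt hL0).trans h1) ((min_le_left _ _).trans h1)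
    have hr2 : (δ / √n) ^ 2 = δ ^ 2 / n := by rw [div_pow, Real.sq_sqrt hn0.le]
    have hdiv : δ ^ 2 / n ≤ δ ^ 2 := div_le_self (by positivity) hn'
    -- For small `p` the support need not be large, but a single coordinate of size `σ₀ δ / √n`
    -- already gives the rate.
    have key := HDLinReg.le_benchmark_of_zero_null (n := n) (κ := 1) (m := 1) (r := δ / √n)
      (α := α) (ε := ε) hcb hσ hξ hk₁ hk one_pos (by omega) hε (by positivity)
      (by rw [hr2]; push_cast; linarith) (by
        refine le_trans ?_ hδε
        rw [hr2]
        push_cast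
        have e1 : (2 : ℝ) * n * (δ ^ 2 / n) = 2 * δ ^ 2 := by field_simp
        have e2 : (n : ℝ) * (1 * (δ ^ 2 / n)) ^ 2 = δ ^ 4 / n := by field_simp
        rw [e1, e2, one_mul, div_one]
        gcongr
        exact div_le_self (by positivity) hn')
    refine le_trans (ENNReal.ofReal_le_ofReal ?_) key
    rw [hgap]
    calc _ ≤ δ * (3 * ε) / (cbar * B) * ‖ξ‖ * σ₀ * (B * (1 / √n)) := by gcongr
      _ = _ := by push_cast; field_simp
  -- For signals below `δ √(log p / n)`, the cost `exp (2 n r²)` is at most `p ^ (2δ²)`, within the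
  -- surplus power of `p`.
  · have he : ∀ r : ℝ, r ^ 2 ≤ δ ^ 2 * L ^ 2 →
        Real.exp (2 * n * r ^ 2) ≤ (p : ℝ) ^ ((γq - 2 * γ) / 2) := by
      intro r hr
      rw [Real.rpow_def_of_pos hp0, Real.exp_le_exp]
      calc 2 * n * r ^ 2 ≤ 2 * n * (δ ^ 2 * L ^ 2) := by gcongr
        _ = Real.log p * (2 * δ ^ 2) := by rw [hLsq]; field_simp
        _ ≤ _ := by gcongr
    have hexp : ∀ r : ℝ, r ^ 2 ≤ δ ^ 2 * L ^ 2 → 0 < q / k ∧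
        k * (Real.exp (2 * n * r ^ 2) - 1) / (q / k : ℕ) ≤ δ ^ 4 := by
      intro r hr
      refine HDLinReg.block_exponent_le hk hδ41 (Real.one_le_exp (by positivity)) ?_
      calc 2 * (k : ℝ) ^ 2 * Real.exp (2 * n * r ^ 2)
          ≤ 2 * (c * (p : ℝ) ^ γ) ^ 2 * (p : ℝ) ^ ((γq - 2 * γ) / 2) := by
            gcongr
            exact he r hr
        _ ≤ δ ^ 4 * (cq * (p : ℝ) ^ γq) := hN p hpN
        _ ≤ _ := by gcongr
    have hkm : k * (q / k) ≤ q := Nat.mul_div_le q k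
    have hc₁ : δ * (3 * ε) / (cbar * B) ≤ δ * (3 * ε) / cbar := by
      gcongr
      exact le_mul_of_one_le_right hcb.le hB1
    rcases max_choice (√((k : ℝ) * k₁) * L) (min (k * L) (√k / (n : ℝ) ^ (1 / 4 : ℝ))) with h | h
    · rw [h]
      have hr : (δ * L) ^ 2 ≤ δ ^ 2 * L ^ 2 := (mul_pow _ _ _).le
      obtain ⟨hm, hx⟩ := hexp _ hr
      have key := HDLinReg.le_benchmark_of_mixture_null (n := n) (k := k) (m := q / k) (r := δ * L)
        (α := α) (ε := ε) hcb hσ hξ hk₁ hk hm hkm hε (by positivity) (by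
          rw [mul_pow, hLsq]
          calc k₁ * (δ ^ 2 * (Real.log p / n)) ≤ k * (δ ^ 2 * (Real.log p / n)) := by gcongr
            _ = δ ^ 2 * (k * Real.log p) / n := by ring
            _ ≤ δ ^ 2 * (c * n) / n := by gcongr
            _ = δ ^ 2 * c := by field_simp
            _ ≤ 1 := hδc) (by
          refine le_trans (Real.exp_le_exp.2 ?_) hδε
          have : 0 ≤ δ ^ 4 := by positivity
          linarith)
      refine le_trans (ENNReal.ofReal_le_ofReal ?_) key
      rw [hgap]
      calc _ ≤ δ * (3 * ε) / cbar * ‖ξ‖ * σ₀ * (√((k : ℝ) * k₁) * L) := by gcongr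
        _ = _ := by ring
    · rw [h]
      set n4 : ℝ := (n : ℝ) ^ (1 / 4 : ℝ) with hn4
      have hn40 : 0 < n4 := by positivity
      have hn44 : n4 ^ 4 = n := by
        rw [hn4, ← Real.rpow_natCast, ← Real.rpow_mul hn0.le]
        norm_num
      have hn41 : 1 ≤ n4 := Real.one_le_rpow hn' (by norm_num)
      set M : ℝ := min (k * L) (√k / n4) with hM
      have hM0 : 0 ≤ M := le_min (by positivity) (by positivity)
      have hML : M / k ≤ L := by
        rw [div_le_iff₀ hk0, mul_comm]
        exact min_le_left _ _
      -- The branch `√k / n ^ (1/4)` of the minimum is exactly what makes the energy `O(n ^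
      -- (-1/2))`, so that its cost `n (k r²)²` is at most `δ ^ 4`.
      have hMk : k * (δ * (M / k)) ^ 2 ≤ δ ^ 2 / n4 ^ 2 := by
        have : M ^ 2 ≤ k / n4 ^ 2 := by
          calc M ^ 2 ≤ (√k / n4) ^ 2 := by gcongr; exact min_le_right _ _
            _ = _ := by rw [div_pow, Real.sq_sqrt hk0.le]
        calc k * (δ * (M / k)) ^ 2 = δ ^ 2 * M ^ 2 / k := by field_simp
          _ ≤ δ ^ 2 * (k / n4 ^ 2) / k := by gcongr
          _ = _ := by field_simp
      have hr : (δ * (M / k)) ^ 2 ≤ δ ^ 2 * L ^ 2 := by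
        rw [mul_pow]
        gcongr
      obtain ⟨hm, hx⟩ := hexp _ hr
      have key := HDLinReg.le_benchmark_of_zero_null (n := n) (κ := k) (m := q / k)
        (r := δ * (M / k)) (α := α) (ε := ε) hcb hσ hξ hk₁ le_rfl hm hkm hε (by positivity)
        (hMk.trans ((div_le_self (by positivity) (one_le_pow₀ hn41)).trans hδ4)) (by
          refine le_trans (Real.exp_le_exp.2 ?_) hδε
          refine add_le_add ?_ (hx.trans hδexp)
          calc n * (k * (δ * (M / k)) ^ 2) ^ 2 ≤ n * (δ ^ 2 / n4 ^ 2) ^ 2 := by gcongr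
            _ = δ ^ 4 := by
              rw [← hn44]
              field_simp)
      refine le_trans (ENNReal.ofReal_le_ofReal ?_) key
      rw [hgap]
      calc _ ≤ δ * (3 * ε) / cbar * ‖ξ‖ * σ₀ * M := by gcongr
        _ = _ := by field_simp
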